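/- Conventions: all manifolds are topological, compact, connected and orientable, and all embeddings are locally flat. A $\mathbb{Z}$-surface in a simply connected closed $4$-manifold $X$ is a closed (connected, orientable, locally flatly embedded) surface $F\subset X$ with $\pi_1(X\smallsetminus F)\cong\mathbb{Z}$. Let $K$ be a knot in $S^3$. For a decomposition $X=X_1\cup_{S^3}X_2$ into two $4$-manifolds $X_1$, $X_2$ with boundary $S^3$, glued along their boundaries, let $$g_{X_1,X_2}(K)=\min\{\operatorname{genus}(F_1\cup_K F_2)\},$$ where the minimum is over all pairs of properly embedded surfaces $F_i\subset X_i$ with $\partial F_i=K$, $i=1,2$, such that $F_1\cup_K F_2$ is a $\mathbb{Z}$-surface in $X$. The $X$-double slice genus $g_{ds}^X(K)$ of $K$ is the minimum of $g_{X_1,X_2}(K)$ over all decompositions $X=X_1\cup_{S^3}X_2$ into $4$-manifolds with boundary $S^3$. (The minimum of the empty set is $\infty$.) **Theorem.** Let $K$ be a knot in $S^3$ and let $X$ be a simply connected closed $4$-manifold. Then $$g_{ds}^X(K)\le g_{ds}^{S^4}(K).$$ -/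

import Mathlib

open Set Topology

/-- The standard unit sphere of dimension `n`, in `ℝ^(n+1)`. -/
abbrev StdSphere (n : ℕ) : Type :=
  Metric.sphere (0 : EuclideanSpace ℝ (Fin (n + 1))) 1

/-- A knot: a locally flat topological embedding of the circle in the 3-sphere.
Locally flat: around each of its points, the pair `(S³, K)` looks like `(ℝ³, ℝ × 0)`. -/
structure Knot where
  toFun : Circle → StdSphere 3
  isEmbedding : IsEmbedding toFun
  locallyFlat : ∀ x ∈ range toFun,
    ∃ φ : OpenPartialHomeomorph (StdSphere 3) (EuclideanSpace ℝ (Fin 3)),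
      x ∈ φ.source ∧ ∀ y ∈ φ.source, y ∈ range toFun ↔ φ y 1 = 0 ∧ φ y 2 = 0

/-- The image of a knot, a subset of the 3-sphere. -/
def Knot.carrier (K : Knot) : Set (StdSphere 3) := range K.toFun

section Surfaces

/-- An embedded Möbius band in a space `F`: the square `[0,1] × [-1,1]` is mapped to `F`
continuously and so that the only points identified are `(0, t)` with `(1, -t)`. -/
def HasMoebiusBand (F : Type*) [TopologicalSpace F] : Prop :=
  ∃ m : ℝ × ℝ → F, ContinuousOn m (Icc 0 1 ×ˢ Icc (-1) 1) ∧
    ∀ p ∈ Icc (0 : ℝ) 1 ×ˢ Icc (-1 : ℝ) 1, ∀ q ∈ Icc (0 : ℝ) 1 ×ˢ Icc (-1 : ℝ) 1,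
      (m p = m q ↔
        p = q ∨ (p.1 = 0 ∧ q.1 = 1 ∧ q.2 = -p.2) ∨ (p.1 = 1 ∧ q.1 = 0 ∧ q.2 = -p.2))

/-- Orientability of a surface (possibly with boundary): it contains no Möbius band. -/
def OrientableSurface (F : Type*) [TopologicalSpace F] : Prop := ¬ HasMoebiusBand F

/-- There are `k` pairwise disjoint simple closed curves in `F` that together do not
separate `F`. -/
def HasNonseparatingCurves (F : Type*) [TopologicalSpace F] (k : ℕ) : Prop :=
  ∃ γ : Fin k → Circle → F,
    (∀ i, IsEmbedding (γ i)) ∧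
    (∀ i j, i ≠ j → Disjoint (range (γ i)) (range (γ j))) ∧
    IsConnected (⋃ i, range (γ i))ᶜ

/-- The genus of a connected orientable surface: the largest number of pairwise disjoint simple
closed curves that together do not separate it. -/
noncomputable def surfaceGenus (F : Type*) [TopologicalSpace F] : ℕ∞ :=
  ⨆ (k : ℕ) (_ : HasNonseparatingCurves F k), (k : ℕ∞)

end Surfaces

section FourManifolds

variable {X : Type*} [TopologicalSpace X]

/-- `A ⊆ X` is a compact connected 4-manifold (in the subspace topology) whose boundary
is `S`. Each point has a chart with values in the half-space `{x | 0 ≤ x 0}` that sends the points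
of `S`, and only these, to the bounding hyperplane. -/
structure IsFourManifoldWithBoundary (A S : Set X) : Prop where
  isCompact : IsCompact A
  isConnected : IsConnected A
  boundary_subset : S ⊆ A
  exists_chart : ∀ x : A, ∃ φ : OpenPartialHomeomorph A (EuclideanHalfSpace 4),
    x ∈ φ.source ∧ ∀ y ∈ φ.source, (y : X) ∈ S ↔ (φ y).1 0 = 0

/-- `F` is a properly embedded surface in the 4-manifold `A` with boundary `S`, and the
boundary of `F` is `C`. That is: `F` is compact, connected and orientable, it meets `S` exactly
in `C`, and it is locally flat, i.e. around each point of `F`, the triple `(A, S, F)` looks like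
the half-space `{x | 0 ≤ x 0}`, its hyperplane `x 0 = 0`, and its half-plane
`x 2 = x 3 = 0` (which makes `F` a surface whose boundary is `F ∩ S`). -/
structure IsProperSurface (A S C F : Set X) : Prop where
  subset : F ⊆ A
  isCompact : IsCompact F
  isConnected : IsConnected F
  orientable : OrientableSurface F
  inter_boundary : F ∩ S = C
  locallyFlat : ∀ x : A, (x : X) ∈ F →
    ∃ φ : OpenPartialHomeomorph A (EuclideanHalfSpace 4), x ∈ φ.source ∧
      (∀ y ∈ φ.source, (y : X) ∈ S ↔ (φ y).1 0 = 0) ∧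
      (∀ y ∈ φ.source, (y : X) ∈ F ↔ (φ y).1 2 = 0 ∧ (φ y).1 3 = 0)

/-- A closed, connected, orientable surface that is locally flat in the closed 4-manifold `X`
and whose complement has infinite cyclic fundamental group. -/
structure IsZSurface (F : Set X) : Prop where
  isCompact : IsCompact F
  isConnected : IsConnected F
  orientable : OrientableSurface F
  locallyFlat : ∀ x ∈ F, ∃ φ : OpenPartialHomeomorph X (EuclideanSpace ℝ (Fin 4)),
    x ∈ φ.source ∧ ∀ y ∈ φ.source, y ∈ F ↔ φ y 2 = 0 ∧ φ y 3 = 0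
  pathConnected_compl : PathConnectedSpace (Fᶜ : Set X)
  fundamentalGroup_compl : ∀ x : (Fᶜ : Set X),
    Nonempty (FundamentalGroup (Fᶜ : Set X) x ≃* Multiplicative ℤ)

variable (X) in
/-- A decomposition `X = X₁ ∪_{S³} X₂` of a closed 4-manifold into two 4-manifolds
that both have the 3-sphere, embedded by `e`, as their boundary, and meet only there. -/
structure SphereSplitting where
  X₁ : Set X
  X₂ : Set X
  e : StdSphere 3 → X
  isEmbedding : IsEmbedding e
  union_eq : X₁ ∪ X₂ = univ
  inter_eq : X₁ ∩ X₂ = range e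
  manifold₁ : IsFourManifoldWithBoundary X₁ (range e)
  manifold₂ : IsFourManifoldWithBoundary X₂ (range e)

/-- The `(X₁, X₂)`-double slice genus of `K`: the least genus of a ℤ-surface `F₁ ∪ F₂` in
`X₁ ∪ X₂`, where `Fᵢ` is a properly embedded surface in `Xᵢ` with boundary `K`
(and `⊤` if there is none). -/
noncomputable def SphereSplitting.doubleSliceGenus (D : SphereSplitting X) (K : Knot) : ℕ∞ :=
  ⨅ (F₁ : Set X) (F₂ : Set X)
    (_ : IsProperSurface D.X₁ (range D.e) (D.e '' K.carrier) F₁)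
    (_ : IsProperSurface D.X₂ (range D.e) (D.e '' K.carrier) F₂)
    (_ : IsZSurface (F₁ ∪ F₂)), surfaceGenus (F₁ ∪ F₂ : Set X)

variable (X) in
/-- The `X`-double slice genus of `K`: the least `(X₁, X₂)`-double slice genus of `K` over all
decompositions `X = X₁ ∪_{S³} X₂` (and `⊤` if there is none). -/
noncomputable def doubleSliceGenus (K : Knot) : ℕ∞ :=
  ⨅ D : SphereSplitting X, D.doubleSliceGenus K

end FourManifolds

/-! The idea is that `X` is the connected sum of `S⁴` and `X`, and that the sum can be formed far
from the surface. Given a splitting of `S⁴` and a ℤ-surface `F₁ ∪ F₂`, pick a point `p` in the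
interior of `X₁` and off the surface. Stereographic projection identifies the complement of `p` with
`ℝ⁴`, and `ℝ⁴` embeds openly in `X` through a chart. Along these two embeddings `g` and `j` the
sphere, the second piece and the surface move into `X` unchanged; the first piece becomes everything
else, that is, `X₁` with a neighbourhood of `p` replaced by the complement of the chart
(`SphereSplitting.exists_push`). Genus and orientability are homeomorphism invariants, and local
flatness is checked in charts.

What has to be proved is that the group of the complement does not change. Both complements are
compared with `ℝ⁴ \ C`, where `C` is the compact set corresponding to the surface
(`compl_image_fundamentalGroup`). Each of them is this set together with the complement of a large
ball. The latter is simply connected because the ambient manifold is, and the overlap is a simply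
connected shell `R < ‖x‖`. So van Kampen's theorem is needed only when one piece and the
intersection are simply connected: injectivity is `quotient_mk_eq_of_map_homotopic`, generation is
`quotient_induction_of_cover`.

The new first piece must also be connected; this is a separation argument,
`isConnected_compl_pushSet`. -/

open unitInterval in
/-- A path with the prescribed underlying continuous map. -/
def ContinuousMap.toPath {Z : Type*} [TopologicalSpace Z] (f : C(I, Z)) : Path (f 0) (f 1) :=
  ⟨f, rfl, rfl⟩

/-! ### Van Kampen, injectivity: homotopies of paths and the cocycle of a path -/

section SquareAndLift

open unitInterval Path

variable {Z : Type*} [TopologicalSpace Z]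

instance : SimplyConnectedSpace (I × I) := by
  have : ContractibleSpace I := (convex_Icc (0 : ℝ) 1).contractibleSpace ⟨0, by simp⟩
  infer_instance

/-- Going around a square both ways gives homotopic paths. -/
theorem square_quotient_eq (H : C(I × I, Z)) :
    (Homotopic.Quotient.mk (H.comp ⟨fun t ↦ (0, t), by fun_prop⟩).toPath).trans
      (Homotopic.Quotient.mk (H.comp ⟨fun t ↦ (t, 1), by fun_prop⟩).toPath) =
    (Homotopic.Quotient.mk (H.comp ⟨fun t ↦ (t, 0), by fun_prop⟩).toPath).trans
      (Homotopic.Quotient.mk (H.comp ⟨fun t ↦ (1, t), by fun_prop⟩).toPath) := by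
  let b : Path ((0, 0) : I × I) (0, 1) := ⟨⟨fun t ↦ (0, t), by fun_prop⟩, rfl, rfl⟩
  let r : Path ((0, 1) : I × I) (1, 1) := ⟨⟨fun t ↦ (t, 1), by fun_prop⟩, rfl, rfl⟩
  let l : Path ((0, 0) : I × I) (1, 0) := ⟨⟨fun t ↦ (t, 0), by fun_prop⟩, rfl, rfl⟩
  let u : Path ((1, 0) : I × I) (1, 1) := ⟨⟨fun t ↦ (1, t), by fun_prop⟩, rfl, rfl⟩
  -- The two edge paths are already homotopic in the square, and `H` carries that homotopy over.
  have h : (b.trans r).Homotopic (l.trans u) := SimplyConnectedSpace.paths_homotopic _ _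
  have h' := h.map H
  rw [Path.map_trans, Path.map_trans] at h'
  exact Homotopic.Quotient.eq.2 h'

/-- Two paths with the same endpoints in a simply connected set are homotopic. -/
theorem IsSimplyConnected.quotient_mk_eq {S : Set Z} (hS : IsSimplyConnected S) {a b : Z}
    (p q : Path a b) (hp : ∀ t, p t ∈ S) (hq : ∀ t, q t ∈ S) :
    Homotopic.Quotient.mk p = Homotopic.Quotient.mk q := by
  have := hS.simplyConnectedSpace
  have ha : a ∈ S := by simpa using hp 0
  have hb : b ∈ S := by simpa using hp 1
  let p' : Path (⟨a, ha⟩ : S) ⟨b, hb⟩ :=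
    ⟨⟨fun t ↦ ⟨p t, hp t⟩, by fun_prop⟩, by simp, by simp⟩
  let q' : Path (⟨a, ha⟩ : S) ⟨b, hb⟩ :=
    ⟨⟨fun t ↦ ⟨q t, hq t⟩, by fun_prop⟩, by simp, by simp⟩
  have h := (SimplyConnectedSpace.paths_homotopic p' q').map ⟨Subtype.val, continuous_subtype_val⟩
  exact Homotopic.Quotient.eq.2 h

end SquareAndLift

section Cocycle

open unitInterval Path

variable {Y : Type*} [TopologicalSpace Y] {U V : Set Y} {x₀ : U}

open Classical in
/-- The loop class in `U` attached to a path `f` in `Y`: if `f` stays in `U`, close it up by the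
chosen paths `c` to the base point; otherwise take the trivial class. -/
noncomputable def pathCocycle (c : ∀ u : U, Path x₀ u) (f : C(I, Y)) :
    Homotopic.Quotient x₀ x₀ :=
  if h : ∀ t, f t ∈ U then
    (Homotopic.Quotient.mk (c ⟨f 0, h 0⟩)).trans
      ((Homotopic.Quotient.mk (⟨fun t ↦ ⟨f t, h t⟩, by fun_prop⟩ : C(I, U)).toPath).trans
        (Homotopic.Quotient.mk (c ⟨f 1, h 1⟩)).symm)
  else Homotopic.Quotient.refl x₀

theorem pathCocycle_coe (c : ∀ u : U, Path x₀ u) (g : C(I, U)) :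
    pathCocycle c (ContinuousMap.comp ⟨Subtype.val, continuous_subtype_val⟩ g) =
      (Homotopic.Quotient.mk (c (g 0))).trans
        ((Homotopic.Quotient.mk g.toPath).trans (Homotopic.Quotient.mk (c (g 1))).symm) := by
  have h : ∀ t, (ContinuousMap.comp ⟨Subtype.val, continuous_subtype_val⟩ g : C(I, Y)) t ∈ U :=
    fun t ↦ (g t).2
  rw [pathCocycle, dif_pos h]
  rfl

/-- The connecting paths to points of `V` stay in `V`, so the closed-up loop lies in `U ∩ V`, where
it contracts. -/
theorem pathCocycle_of_forall_mem (c : ∀ u : U, Path x₀ u)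
    (hc : ∀ u : U, (u : Y) ∈ V → ∀ t, (c u t : Y) ∈ V)
    (hUV : IsSimplyConnected (Subtype.val ⁻¹' V : Set U)) (f : C(I, Y)) (hf : ∀ t, f t ∈ V) :
    pathCocycle c f = Homotopic.Quotient.refl x₀ := by
  rw [pathCocycle]
  split_ifs with h
  · have key : (Homotopic.Quotient.mk (c ⟨f 0, h 0⟩)).trans
        (Homotopic.Quotient.mk (⟨fun t ↦ ⟨f t, h t⟩, by fun_prop⟩ : C(I, U)).toPath) =
        Homotopic.Quotient.mk (c ⟨f 1, h 1⟩) := by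
      rw [← Homotopic.Quotient.mk_trans]
      refine hUV.quotient_mk_eq _ _ (fun t ↦ ?_) (hc _ (hf 1))
      rw [Path.trans_apply]
      split_ifs
      · exact hc _ (hf 0) _
      · exact hf _
    rw [← Homotopic.Quotient.trans_assoc, key, Homotopic.Quotient.trans_symm]
  · rfl

theorem pathCocycle_const (c : ∀ u : U, Path x₀ u) (y : Y) :
    pathCocycle c (.const I y) = Homotopic.Quotient.refl x₀ := by
  rw [pathCocycle]
  split_ifs with h
  · have : (Homotopic.Quotient.mk (⟨fun t ↦ ⟨(ContinuousMap.const I y) t, h t⟩, by fun_prop⟩ : C(I, U)).toPath) =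
        Homotopic.Quotient.refl (⟨y, h 0⟩ : U) := rfl
    rw [this]
    erw [Homotopic.Quotient.refl_trans, Homotopic.Quotient.trans_symm]
  · rfl

/-- Inside `U` the connecting paths cancel at the corners and the square itself gives the relation;
inside `V` all four sides have trivial class. -/
theorem pathCocycle_square (c : ∀ u : U, Path x₀ u)
    (hc : ∀ u : U, (u : Y) ∈ V → ∀ t, (c u t : Y) ∈ V)
    (hUV : IsSimplyConnected (Subtype.val ⁻¹' V : Set U)) (H : C(I × I, Y))
    (hH : (∀ p, H p ∈ U) ∨ ∀ p, H p ∈ V) :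
    (pathCocycle c (H.comp ⟨fun t ↦ (0, t), by fun_prop⟩)).trans
      (pathCocycle c (H.comp ⟨fun t ↦ (t, 1), by fun_prop⟩)) =
    (pathCocycle c (H.comp ⟨fun t ↦ (t, 0), by fun_prop⟩)).trans
      (pathCocycle c (H.comp ⟨fun t ↦ (1, t), by fun_prop⟩)) := by
  rcases hH with hH | hH
  · obtain ⟨G, rfl⟩ : ∃ G : C(I × I, U), H = .comp ⟨Subtype.val, continuous_subtype_val⟩ G :=
      ⟨⟨fun p ↦ ⟨H p, hH p⟩, by fun_prop⟩, rfl⟩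
    simp only [ContinuousMap.comp_assoc, pathCocycle_coe]
    have := square_quotient_eq G
    simp only [ContinuousMap.comp_apply, ContinuousMap.coe_mk] at this ⊢
    grind
  · rw [pathCocycle_of_forall_mem c hc hUV _ fun t ↦ hH _,
      pathCocycle_of_forall_mem c hc hUV _ fun t ↦ hH _,
      pathCocycle_of_forall_mem c hc hUV _ fun t ↦ hH _,
      pathCocycle_of_forall_mem c hc hUV _ fun t ↦ hH _]

end Cocycle

/-! ### Van Kampen, injectivity: subdividing a homotopy into a grid -/

section Grid

open unitInterval Path

variable {Y : Type*} [TopologicalSpace Y] {U V : Set Y} {x₀ : U}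

/-- The product of the cocycle over the first `n` pieces of the path `H (s, ·)`, for the
partition `t` of the unit interval. -/
noncomputable def gridProduct (c : ∀ u : U, Path x₀ u) (H : C(I × I, Y)) (t : ℕ → I) (s : I) :
    ℕ → Homotopic.Quotient x₀ x₀
  | 0 => Homotopic.Quotient.refl x₀
  | n + 1 => (gridProduct c H t s n).trans
      (pathCocycle c (H.comp ⟨fun r ↦ (s, Set.Icc.convexComb (t n) (t (n + 1)) r), by fun_prop⟩))

/-- Pasting the relations of the small squares between heights `s` and `s'`: the inner vertical
sides cancel, and only the outer two remain. -/
theorem gridProduct_trans_pathCocycle (c : ∀ u : U, Path x₀ u)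
    (hc : ∀ u : U, (u : Y) ∈ V → ∀ t, (c u t : Y) ∈ V)
    (hUV : IsSimplyConnected (Subtype.val ⁻¹' V : Set U)) (H : C(I × I, Y)) (t : ℕ → I)
    (ht0 : t 0 = 0) (s s' : I)
    (hH : ∀ n, (∀ p q, H (Set.Icc.convexComb s s' p, Set.Icc.convexComb (t n) (t (n + 1)) q) ∈ U) ∨
      ∀ p q, H (Set.Icc.convexComb s s' p, Set.Icc.convexComb (t n) (t (n + 1)) q) ∈ V) (n : ℕ) :
    (gridProduct c H t s n).trans
        (pathCocycle c (H.comp ⟨fun r ↦ (Set.Icc.convexComb s s' r, t n), by fun_prop⟩)) =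
      (pathCocycle c (H.comp ⟨fun r ↦ (Set.Icc.convexComb s s' r, 0), by fun_prop⟩)).trans
        (gridProduct c H t s' n) := by
  induction n with
  | zero => simp [gridProduct, ht0]
  | succ n ih =>
    have key := pathCocycle_square (V := V) c hc hUV
      (H.comp ⟨fun p : I × I ↦ (Set.Icc.convexComb s s' p.1,
        Set.Icc.convexComb (t n) (t (n + 1)) p.2), by unfold Set.Icc.convexComb; fun_prop⟩)
      ((hH n).imp (fun h p ↦ h _ _) (fun h p ↦ h _ _))
    simp only [ContinuousMap.comp, ContinuousMap.coe_mk,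
      Function.comp_def, Set.Icc.convexComb_zero, Set.Icc.convexComb_one] at key ih ⊢
    simp only [gridProduct, ContinuousMap.comp, ContinuousMap.coe_mk, Function.comp_def]
    rw [Homotopic.Quotient.trans_assoc, key, ← Homotopic.Quotient.trans_assoc, ih,
      Homotopic.Quotient.trans_assoc]

theorem pathCocycle_path (c : ∀ u : U, Path x₀ u) {x y : U} (p : Path x y) :
    pathCocycle c (ContinuousMap.comp ⟨Subtype.val, continuous_subtype_val⟩ p.toContinuousMap) =
      (Homotopic.Quotient.mk (c x)).trans
        ((Homotopic.Quotient.mk p).trans (Homotopic.Quotient.mk (c y)).symm) := by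
  obtain ⟨f, rfl, rfl⟩ := p
  exact pathCocycle_coe c f

/-- When the row is a path in `U`, the product telescopes, since consecutive connecting paths
cancel. -/
theorem gridProduct_eq_of_row (c : ∀ u : U, Path x₀ u) {x y : U} (γ : Path x y)
    (H : C(I × I, Y)) (t : ℕ → I) (ht0 : t 0 = 0) (s : I) (hγ : ∀ r, H (s, r) = γ r) (n : ℕ) :
    gridProduct c H t s n = (Homotopic.Quotient.mk (c (γ 0))).trans
      ((Homotopic.Quotient.mk (γ.subpath 0 (t n))).trans
        (Homotopic.Quotient.mk (c (γ (t n)))).symm) := by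
  induction n with
  | zero =>
    rw [ht0, Path.subpath_self, Homotopic.Quotient.mk_refl]
    simp [gridProduct]
  | succ n ih =>
    have h1 : (H.comp ⟨fun r ↦ (s, Set.Icc.convexComb (t n) (t (n + 1)) r), by fun_prop⟩) =
        ContinuousMap.comp ⟨Subtype.val, continuous_subtype_val⟩
          (γ.subpath (t n) (t (n + 1))).toContinuousMap := by
      ext r
      exact hγ _
    have h3 : pathCocycle c (ContinuousMap.comp ⟨Subtype.val, continuous_subtype_val⟩
          (γ.subpath (t n) (t (n + 1))).toContinuousMap) =
        (Homotopic.Quotient.mk (c (γ (t n)))).trans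
          ((Homotopic.Quotient.mk (γ.subpath (t n) (t (n + 1)))).trans
            (Homotopic.Quotient.mk (c (γ (t (n + 1))))).symm) := by
      exact pathCocycle_path c _
    have h4 : Homotopic.Quotient.mk (γ.subpath 0 (t (n + 1))) =
        (Homotopic.Quotient.mk (γ.subpath 0 (t n))).trans
          (Homotopic.Quotient.mk (γ.subpath (t n) (t (n + 1)))) := by
      rw [← Homotopic.Quotient.mk_trans]
      exact (Homotopic.Quotient.eq.2 ⟨Path.Homotopy.subpathTransSubpath γ _ _ _⟩).symm
    rw [gridProduct, ih, h1, h3, h4]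
    grind

/-- A path homotopy in `Y = U ∪ V` between paths in `U` can be replaced by one in `U`, if
`U ∩ V` is simply connected. -/
theorem quotient_mk_eq_of_map_homotopic (hU : IsOpen U) (hV : IsOpen V) (hcov : U ∪ V = univ)
    [PathConnectedSpace U] (hUV : IsSimplyConnected (Subtype.val ⁻¹' V : Set U)) {x y : U}
    (γ γ' : Path x y)
    (h : (γ.map continuous_subtype_val).Homotopic (γ'.map continuous_subtype_val)) :
    Homotopic.Quotient.mk γ = Homotopic.Quotient.mk γ' := by
  obtain ⟨x₀, hx₀⟩ := hUV.nonempty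
  obtain ⟨c, hc⟩ : ∃ c : ∀ u : U, Path x₀ u, ∀ u : U, (u : Y) ∈ V → ∀ t, (c u t : Y) ∈ V := by
    have : ∀ u : U, ∃ p : Path x₀ u, (u : Y) ∈ V → ∀ t, (p t : Y) ∈ V := by
      intro u
      by_cases hu : (u : Y) ∈ V
      · obtain ⟨p, hp⟩ := hUV.isPathConnected.joinedIn x₀ hx₀ u hu
        exact ⟨p, fun _ ↦ hp⟩
      · exact ⟨PathConnectedSpace.somePath x₀ u, fun h ↦ absurd h hu⟩
    choose c hc using this
    exact ⟨c, hc⟩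
  obtain ⟨F⟩ := h
  let H : C(I × I, Y) := F.toContinuousMap
  obtain ⟨t, ht0, htm, ⟨N, hN⟩, ht⟩ := exists_monotone_Icc_subset_open_cover_unitInterval_prod_self
    (c := fun b : Bool ↦ H ⁻¹' (cond b U V))
    (by rintro (_ | _); exacts [hV.preimage H.continuous, hU.preimage H.continuous])
    (fun p _ ↦ by
      rcases (hcov ▸ mem_univ (H p) : H p ∈ U ∪ V) with h | h
      · exact mem_iUnion.2 ⟨true, h⟩
      · exact mem_iUnion.2 ⟨false, h⟩)
  have hsq : ∀ m n, (∀ p q, H (Set.Icc.convexComb (t m) (t (m + 1)) p,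
        Set.Icc.convexComb (t n) (t (n + 1)) q) ∈ U) ∨
      ∀ p q, H (Set.Icc.convexComb (t m) (t (m + 1)) p,
        Set.Icc.convexComb (t n) (t (n + 1)) q) ∈ V := by
    intro m n
    obtain ⟨b, hb⟩ := ht m n
    have hmem : ∀ p q, H (Set.Icc.convexComb (t m) (t (m + 1)) p,
        Set.Icc.convexComb (t n) (t (n + 1)) q) ∈ cond b U V := fun p q ↦
      @hb (_, _) ⟨⟨Set.Icc.le_convexComb (htm m.le_succ) p, Set.Icc.convexComb_le (htm m.le_succ) p⟩,
        ⟨Set.Icc.le_convexComb (htm n.le_succ) q, Set.Icc.convexComb_le (htm n.le_succ) q⟩⟩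
    cases b
    · exact .inr hmem
    · exact .inl hmem
  -- The homotopy fixes endpoints, so the outer vertical sides of the grid are constant and
  -- contribute nothing: all rows have the same product.
  have hrow : ∀ m, gridProduct c H t (t m) N = gridProduct c H t 0 N := by
    intro m
    induction m with
    | zero => rw [ht0]
    | succ m ih =>
      have key := gridProduct_trans_pathCocycle (V := V) c hc hUV H t ht0 (t m) (t (m + 1))
        (hsq m) N
      have e0 : (H.comp ⟨fun r ↦ (Set.Icc.convexComb (t m) (t (m + 1)) r, 0), by fun_prop⟩) =
          .const I (x : Y) := by
        ext r
        exact F.source _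
      have e1 : (H.comp ⟨fun r ↦ (Set.Icc.convexComb (t m) (t (m + 1)) r, t N), by fun_prop⟩) =
          .const I (y : Y) := by
        ext r
        rw [hN N le_rfl]
        exact F.target _
      rw [e0, e1, pathCocycle_const, pathCocycle_const, Homotopic.Quotient.trans_refl,
        Homotopic.Quotient.refl_trans] at key
      rw [← key, ih]
  have h0 := gridProduct_eq_of_row c γ H t ht0 0 (fun r ↦ F.apply_zero r) N
  have h1 := gridProduct_eq_of_row c γ' H t ht0 1 (fun r ↦ F.apply_one r) N
  rw [← hrow N, hN N le_rfl, h1] at h0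
  have hcast : ∀ δ : Path x y, (Homotopic.Quotient.mk (c (δ 0))).trans
      ((Homotopic.Quotient.mk (δ.subpath 0 1)).trans (Homotopic.Quotient.mk (c (δ 1))).symm) =
      (Homotopic.Quotient.mk (c x)).trans
        ((Homotopic.Quotient.mk δ).trans (Homotopic.Quotient.mk (c y)).symm) := by
    rintro ⟨f, rfl, rfl⟩
    rw [Path.subpath_zero_one]
    rfl
  rw [hN N le_rfl, hcast, hcast] at h0
  -- The product is the class of the path conjugated by the connecting paths, which is undone here.
  have hcancel : ∀ δ : Homotopic.Quotient x y, δ = (Homotopic.Quotient.mk (c x)).symm.trans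
      (((Homotopic.Quotient.mk (c x)).trans (δ.trans (Homotopic.Quotient.mk (c y)).symm)).trans
        (Homotopic.Quotient.mk (c y))) := by
    intro δ
    simp only [Homotopic.Quotient.trans_assoc, Homotopic.Quotient.symm_trans,
      Homotopic.Quotient.trans_refl]
    rw [← Homotopic.Quotient.trans_assoc, Homotopic.Quotient.symm_trans,
      Homotopic.Quotient.refl_trans]
  rw [hcancel (Homotopic.Quotient.mk γ), ← h0, ← hcancel]

end Grid

/-! ### Van Kampen: generation by loops in the pieces, and the resulting isomorphism -/

section VanKampen

open unitInterval Path

variable {Y : Type*} [TopologicalSpace Y] {U V : Set Y}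

theorem Path.Homotopic.Quotient.trans_cancel_middle {a b c x y : Y} (d : Homotopic.Quotient x a)
    (p : Homotopic.Quotient a b) (e : Homotopic.Quotient y b) (q : Homotopic.Quotient b c)
    (f : Homotopic.Quotient x c) :
    (d.trans (p.trans e.symm)).trans (e.trans (q.trans f.symm)) =
      d.trans ((p.trans q).trans f.symm) := by
  grind

/-- Every path in `U ∪ V` can be cut into pieces each of which lies in `U` or in `V`. -/
theorem Path.exists_partition (hU : IsOpen U) (hV : IsOpen V) (hcov : U ∪ V = univ) {a b : Y}
    (γ : Path a b) : ∃ t : ℕ → I, t 0 = 0 ∧ (∃ n, t n = 1) ∧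
      ∀ n, (∀ r, γ.subpath (t n) (t (n + 1)) r ∈ U) ∨
        ∀ r, γ.subpath (t n) (t (n + 1)) r ∈ V := by
  obtain ⟨t, ht0, htm, ⟨N, hN⟩, ht⟩ := exists_monotone_Icc_subset_open_cover_unitInterval
    (c := fun b : Bool ↦ γ ⁻¹' (cond b U V))
    (by rintro (_ | _); exacts [hV.preimage γ.continuous, hU.preimage γ.continuous])
    (fun p _ ↦ by
      rcases (hcov ▸ mem_univ (γ p) : γ p ∈ U ∪ V) with h | h
      · exact mem_iUnion.2 ⟨true, h⟩
      · exact mem_iUnion.2 ⟨false, h⟩)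
  refine ⟨t, ht0, ⟨N, hN N le_rfl⟩, fun n ↦ ?_⟩
  obtain ⟨b, hb⟩ := ht n
  have hmem : ∀ r, γ.subpath (t n) (t (n + 1)) r ∈ cond b U V := fun r ↦
    hb ⟨Set.Icc.le_convexComb (htm n.le_succ) r, Set.Icc.convexComb_le (htm n.le_succ) r⟩
  cases b
  · exact .inr hmem
  · exact .inl hmem

/-- If `U ∪ V` and `U ∩ V` are path connected, so is `U`. -/
theorem IsPathConnected.of_union_of_inter (hU : IsOpen U) (hV : IsOpen V) (hcov : U ∪ V = univ)
    [PathConnectedSpace Y] (hUV : IsPathConnected (U ∩ V)) : IsPathConnected U := by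
  obtain ⟨x₀, hx₀⟩ := hUV.nonempty
  refine ⟨x₀, hx₀.1, fun {y} hy ↦ ?_⟩
  let γ := PathConnectedSpace.somePath x₀ y
  obtain ⟨t, ht0, ⟨N, hN⟩, ht⟩ := γ.exists_partition hU hV hcov
  have key : ∀ n, γ (t n) ∈ U → JoinedIn U x₀ (γ (t n)) := by
    intro n
    induction n with
    | zero =>
      intro h
      rw [ht0, γ.source] at h ⊢
      exact .refl h
    | succ n ih =>
      intro h
      rcases ht n with h' | h'
      · exact (ih (by simpa using h' 0)).trans ⟨_, h'⟩
      -- A piece lying in `V` whose end is in `U` ends in `U ∩ V`, so the end is joined to `x₀`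
      -- there directly, without the induction hypothesis.
      · exact (hUV.joinedIn x₀ hx₀ _ ⟨h, by simpa using h' 1⟩).mono inter_subset_left
  have := key N
  rw [hN, γ.target] at this
  exact this hy

/-- The fundamental group of `U ∪ V` is generated by the loops in `U` and the loops in `V`, if
`U`, `V` and `U ∩ V` are path connected. -/
theorem quotient_induction_of_cover (hU : IsOpen U) (hV : IsOpen V) (hcov : U ∪ V = univ)
    (hU' : IsPathConnected U) (hV' : IsPathConnected V) (hUV : IsPathConnected (U ∩ V)) {x₀ : Y}
    (hx₀ : x₀ ∈ U ∩ V) (S : Set (Homotopic.Quotient x₀ x₀))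
    (hS : ∀ p ∈ S, ∀ q ∈ S, p.trans q ∈ S)
    (hSU : ∀ p : Path x₀ x₀, (∀ t, p t ∈ U) → Homotopic.Quotient.mk p ∈ S)
    (hSV : ∀ p : Path x₀ x₀, (∀ t, p t ∈ V) → Homotopic.Quotient.mk p ∈ S)
    (g : Homotopic.Quotient x₀ x₀) : g ∈ S := by
  obtain ⟨d, hdU, hdV⟩ : ∃ d : ∀ y : Y, Path x₀ y, (∀ y ∈ U, ∀ t, d y t ∈ U) ∧
      ∀ y ∈ V, ∀ t, d y t ∈ V := by
    have : ∀ y : Y, ∃ p : Path x₀ y, (y ∈ U → ∀ t, p t ∈ U) ∧ (y ∈ V → ∀ t, p t ∈ V) := by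
      intro y
      by_cases hyU : y ∈ U
      · by_cases hyV : y ∈ V
        · obtain ⟨p, hp⟩ := hUV.joinedIn x₀ hx₀ y ⟨hyU, hyV⟩
          exact ⟨p, fun _ t ↦ (hp t).1, fun _ t ↦ (hp t).2⟩
        · obtain ⟨p, hp⟩ := hU'.joinedIn x₀ hx₀.1 y hyU
          exact ⟨p, fun _ t ↦ hp t, fun h ↦ absurd h hyV⟩
      · have hyV : y ∈ V := ((hcov ▸ mem_univ y : y ∈ U ∪ V)).resolve_left hyU
        obtain ⟨p, hp⟩ := hV'.joinedIn x₀ hx₀.2 y hyV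
        exact ⟨p, fun h ↦ absurd h hyU, fun _ t ↦ hp t⟩
    choose d hd using this
    exact ⟨d, fun y ↦ (hd y).1, fun y ↦ (hd y).2⟩
  have hrefl : Homotopic.Quotient.refl x₀ ∈ S := hSU (Path.refl x₀) fun _ ↦ hx₀.1
  have htrans : ∀ (W : Set Y) {a b c : Y} (p : Path a b) (q : Path b c), (∀ t, p t ∈ W) →
      (∀ t, q t ∈ W) → ∀ t, p.trans q t ∈ W := by
    intro W a b c p q hp hq t
    rw [Path.trans_apply]
    split_ifs
    exacts [hp _, hq _]
  obtain ⟨γ, rfl⟩ := Homotopic.Quotient.mk_surjective g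
  obtain ⟨t, ht0, ⟨N, hN⟩, ht⟩ := γ.exists_partition hU hV hcov
  -- Joining each cut point to `x₀` writes the initial segments as products of loops lying in `U` or
  -- in `V`.
  have key : ∀ n, (Homotopic.Quotient.mk (d (γ 0))).trans
      ((Homotopic.Quotient.mk (γ.subpath 0 (t n))).trans
        (Homotopic.Quotient.mk (d (γ (t n)))).symm) ∈ S := by
    intro n
    induction n with
    | zero =>
      rw [ht0, Path.subpath_self, Homotopic.Quotient.mk_refl]
      simpa using hrefl
    | succ n ih =>
      have h4 : Homotopic.Quotient.mk (γ.subpath 0 (t (n + 1))) =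
          (Homotopic.Quotient.mk (γ.subpath 0 (t n))).trans
            (Homotopic.Quotient.mk (γ.subpath (t n) (t (n + 1)))) := by
        rw [← Homotopic.Quotient.mk_trans]
        exact (Homotopic.Quotient.eq.2 ⟨Path.Homotopy.subpathTransSubpath γ _ _ _⟩).symm
      have h5 : (Homotopic.Quotient.mk (d (γ (t n)))).trans
          ((Homotopic.Quotient.mk (γ.subpath (t n) (t (n + 1)))).trans
            (Homotopic.Quotient.mk (d (γ (t (n + 1))))).symm) ∈ S := by
        rw [← Homotopic.Quotient.mk_symm, ← Homotopic.Quotient.mk_trans,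
          ← Homotopic.Quotient.mk_trans]
        rcases ht n with h | h
        · exact hSU _ (htrans U _ _ (hdU _ (by simpa using h 0))
            (htrans U _ _ h fun r ↦ hdU _ (by simpa using h 1) _))
        · exact hSV _ (htrans V _ _ (hdV _ (by simpa using h 0))
            (htrans V _ _ h fun r ↦ hdV _ (by simpa using h 1) _))
      have := hS _ ih _ h5
      rwa [Homotopic.Quotient.trans_cancel_middle, ← h4] at this
  have hcast : ∀ {a b : Y} (δ : Path a b), (Homotopic.Quotient.mk (d (δ 0))).trans
      ((Homotopic.Quotient.mk (δ.subpath 0 1)).trans (Homotopic.Quotient.mk (d (δ 1))).symm) ∈ S →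
      (Homotopic.Quotient.mk (d a)).trans
        ((Homotopic.Quotient.mk δ).trans (Homotopic.Quotient.mk (d b)).symm) ∈ S := by
    rintro a b ⟨f, rfl, rfl⟩ h
    rw [Path.subpath_zero_one] at h
    exact h
  have h := key N
  rw [hN] at h
  have h' := hS _ (hS _ (hSU (d x₀).symm fun r ↦ hdU _ hx₀.1 _) _ (hcast γ h)) _
    (hSU (d x₀) fun r ↦ hdU _ hx₀.1 _)
  convert h' using 1
  rw [Homotopic.Quotient.mk_symm]
  simp only [Homotopic.Quotient.trans_assoc, Homotopic.Quotient.symm_trans,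
    Homotopic.Quotient.trans_refl]
  rw [← Homotopic.Quotient.trans_assoc, Homotopic.Quotient.symm_trans,
    Homotopic.Quotient.refl_trans]

theorem IsSimplyConnected.preimage_subtypeVal {A B : Set Y} (h : IsSimplyConnected (A ∩ B)) :
    IsSimplyConnected (Subtype.val ⁻¹' B : Set A) := by
  rw [← (IsEmbedding.subtypeVal (p := (· ∈ A))).isSimplyConnected_image,
    Subtype.image_preimage_coe]
  exact h

/-- A space covered by two simply connected open sets with path connected intersection is
simply connected. -/
theorem SimplyConnectedSpace.of_union (hU : IsOpen U) (hV : IsOpen V) (hcov : U ∪ V = univ)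
    (hU' : IsSimplyConnected U) (hV' : IsSimplyConnected V) (hUV : IsPathConnected (U ∩ V)) :
    SimplyConnectedSpace Y := by
  have hpc : PathConnectedSpace Y := by
    rw [pathConnectedSpace_iff_univ, ← hcov]
    exact hU'.isPathConnected.union hV'.isPathConnected hUV.nonempty
  obtain ⟨x₀, hx₀⟩ := hUV.nonempty
  have htriv : ∀ g : Homotopic.Quotient x₀ x₀, g = .refl x₀ :=
    quotient_induction_of_cover hU hV hcov hU'.isPathConnected hV'.isPathConnected hUV hx₀
      {.refl x₀} (by rintro p rfl q rfl; simp)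
      (fun p hp ↦ hU'.quotient_mk_eq p (.refl _) hp fun _ ↦ hx₀.1)
      (fun p hp ↦ hV'.quotient_mk_eq p (.refl _) hp fun _ ↦ hx₀.2)
  rw [simply_connected_iff_loops_nullhomotopic]
  refine ⟨hpc, fun x γ ↦ Homotopic.Quotient.eq.1 ?_⟩
  let δ := Homotopic.Quotient.mk (PathConnectedSpace.somePath x₀ x)
  have h := htriv (δ.trans ((Homotopic.Quotient.mk γ).trans δ.symm))
  have h' := congrArg (fun g ↦ δ.symm.trans (g.trans δ)) h
  rw [Homotopic.Quotient.mk_refl]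
  simp only [Homotopic.Quotient.trans_assoc, Homotopic.Quotient.symm_trans,
    Homotopic.Quotient.trans_refl, Homotopic.Quotient.refl_trans] at h'
  rwa [← Homotopic.Quotient.trans_assoc, Homotopic.Quotient.symm_trans,
    Homotopic.Quotient.refl_trans] at h'

/-- If `Y = U ∪ V` with `V` and `U ∩ V` simply connected, the inclusion of `U` is an isomorphism
on fundamental groups. -/
theorem bijective_fundamentalGroup_map_val (hU : IsOpen U) (hV : IsOpen V) (hcov : U ∪ V = univ)
    (hU' : IsPathConnected U) (hV' : IsSimplyConnected V) (hUV : IsSimplyConnected (U ∩ V))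
    (x : U) (hx : (x : Y) ∈ V) :
    Function.Bijective (FundamentalGroup.map (⟨Subtype.val, continuous_subtype_val⟩ : C(U, Y)) x) := by
  have : PathConnectedSpace U := isPathConnected_iff_pathConnectedSpace.1 hU'
  constructor
  · intro g g' h
    obtain ⟨γ, rfl⟩ := Homotopic.Quotient.mk_surjective g
    obtain ⟨γ', rfl⟩ := Homotopic.Quotient.mk_surjective g'
    exact quotient_mk_eq_of_map_homotopic hU hV hcov hUV.preimage_subtypeVal γ γ'
      (Homotopic.Quotient.eq.1 h)
  · refine quotient_induction_of_cover hU hV hcov hU' hV'.isPathConnected hUV.isPathConnected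
      ⟨x.2, hx⟩ (Set.range (FundamentalGroup.map
        (⟨Subtype.val, continuous_subtype_val⟩ : C(U, Y)) x)) ?_ ?_ ?_
    · rintro _ ⟨p, rfl⟩ _ ⟨q, rfl⟩
      -- Multiplication in `FundamentalGroup` is concatenation in the reverse order.
      exact ⟨q * p, MonoidHom.map_mul (FundamentalGroup.map _ x) q p⟩
    · intro p hp
      exact ⟨Homotopic.Quotient.mk (⟨⟨fun t ↦ ⟨p t, hp t⟩, by fun_prop⟩, by simp, by simp⟩ :
        Path x x), rfl⟩
    · intro p hp
      exact ⟨1, (MonoidHom.map_one (FundamentalGroup.map _ x)).trans (hV'.quotient_mk_eq (.refl _) p (fun _ ↦ hx) hp)⟩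

theorem nonempty_fundamentalGroup_mulEquiv_of_homeomorph {A B : Type*} [TopologicalSpace A]
    [TopologicalSpace B] (e : A ≃ₜ B) (a : A) :
    Nonempty (FundamentalGroup A a ≃* FundamentalGroup B (e a)) :=
  ⟨MulEquiv.ofBijective (FundamentalGroup.map (e : C(A, B)) a) <| by
    let E := FundamentalGroupoidFunctor.equivOfHomotopyEquiv e.toHomotopyEquiv
    exact (E.fullyFaithfulFunctor.map_bijective ⟨a⟩ ⟨a⟩)⟩

/-- If `Y = i(A) ∪ V` with `V` and `i(A) ∩ V` simply connected, then `A` and `Y` have the same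
fundamental group. -/
theorem Topology.IsOpenEmbedding.nonempty_fundamentalGroup_mulEquiv {A : Type*}
    [TopologicalSpace A] {i : A → Y} (hi : IsOpenEmbedding i) (hV : IsOpen V)
    (hcov : range i ∪ V = univ) (hV' : IsSimplyConnected V)
    (hUV : IsSimplyConnected (range i ∩ V)) [PathConnectedSpace A] [PathConnectedSpace Y]
    (a : A) (y : Y) : Nonempty (FundamentalGroup A a ≃* FundamentalGroup Y y) := by
  obtain ⟨_, ⟨b, rfl⟩, hb⟩ := hUV.nonempty
  obtain ⟨e⟩ := nonempty_fundamentalGroup_mulEquiv_of_homeomorph hi.toIsEmbedding.toHomeomorph b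
  exact ⟨(FundamentalGroup.fundamentalGroupMulEquivOfPathConnected a b).trans <| e.trans <|
    (MulEquiv.ofBijective _ (bijective_fundamentalGroup_map_val hi.isOpen_range hV hcov
      (isPathConnected_range hi.continuous) hV' hUV ⟨i b, mem_range_self b⟩ hb)).trans <|
    FundamentalGroup.fundamentalGroupMulEquivOfPathConnected _ y⟩

theorem Topology.IsOpenEmbedding.pathConnectedSpace_iff {A : Type*}
    [TopologicalSpace A] {i : A → Y} (hi : IsOpenEmbedding i) (hV : IsOpen V)
    (hcov : range i ∪ V = univ) (hV' : IsPathConnected V)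
    (hUV : IsPathConnected (range i ∩ V)) : PathConnectedSpace A ↔ PathConnectedSpace Y := by
  have h : PathConnectedSpace A ↔ IsPathConnected (range i) := by
    rw [pathConnectedSpace_iff_univ, hi.isInducing.isPathConnected_iff, image_univ]
  rw [h]
  refine ⟨fun h ↦ ?_, fun h ↦ .of_union_of_inter hi.isOpen_range hV hcov hUV⟩
  rw [pathConnectedSpace_iff_univ, ← hcov]
  exact h.union hV' hUV.nonempty

end VanKampen

/-! ### Simple connectivity of spheres and of shells -/

theorem fact_finrank_euclideanSpace (n : ℕ) :
    Fact (Module.finrank ℝ (EuclideanSpace ℝ (Fin n)) = n) :=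
  ⟨finrank_euclideanSpace_fin⟩

attribute [local instance] fact_finrank_euclideanSpace

/-- Inverse stereographic projection from the point `v`. -/
noncomputable def inverseStereographic (n : ℕ) (v : StdSphere n) :
    EuclideanSpace ℝ (Fin n) → StdSphere n :=
  (stereographic' n v).symm

theorem isOpenEmbedding_inverseStereographic (n : ℕ) (v : StdSphere n) :
    IsOpenEmbedding (inverseStereographic n v) :=
  (stereographic' n v).symm.isOpenEmbedding (by simp)

theorem range_inverseStereographic (n : ℕ) (v : StdSphere n) :
    range (inverseStereographic n v) = {v}ᶜ := by
  have := (stereographic' n v).symm.image_source_eq_target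
  simpa [inverseStereographic] using this

theorem isSimplyConnected_univ_of_contractible (E : Type*) [TopologicalSpace E]
    [ContractibleSpace E] : IsSimplyConnected (univ : Set E) :=
  (Homeomorph.Set.univ E).toHomotopyEquiv.simplyConnectedSpace

/-- Two antipodal punctured spheres are copies of `ℝⁿ`, and they meet in `ℝⁿ` minus a point, which
is path connected for `n ≥ 2`. -/
theorem simplyConnectedSpace_stdSphere {n : ℕ} (hn : 2 ≤ n) :
    SimplyConnectedSpace (StdSphere n) := by
  let v : StdSphere n := ⟨EuclideanSpace.single 0 1, by simp⟩
  have hne : -v ≠ v := by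
    intro h
    have := congrArg (fun x : StdSphere n ↦ (x : EuclideanSpace ℝ (Fin (n + 1))) 0) h
    norm_num [v] at this
  have hsc : ∀ w : StdSphere n, IsSimplyConnected ({w}ᶜ : Set (StdSphere n)) := by
    intro w
    rw [← range_inverseStereographic, ← image_univ,
      (isOpenEmbedding_inverseStereographic n w).isEmbedding.isSimplyConnected_image]
    exact isSimplyConnected_univ_of_contractible _
  refine .of_union (U := {v}ᶜ) (V := {-v}ᶜ) isOpen_compl_singleton isOpen_compl_singleton ?_
    (hsc _) (hsc _) ?_
  · rw [← compl_inter, singleton_inter_eq_empty.2 (by simpa using hne.symm), compl_empty]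
  · obtain ⟨w, hw⟩ : -v ∈ range (inverseStereographic n v) := by
      rw [range_inverseStereographic]
      exact hne
    have : ({v}ᶜ ∩ {-v}ᶜ : Set (StdSphere n)) = inverseStereographic n v '' {w}ᶜ := by
      rw [image_compl_eq_range_sdiff_image (isOpenEmbedding_inverseStereographic n v).injective,
        range_inverseStereographic, image_singleton, hw, sdiff_eq]
    rw [this]
    refine (isPathConnected_compl_singleton_of_one_lt_rank ?_ w).image
      (isOpenEmbedding_inverseStereographic n v).continuous
    rw [rank_eq_card_basis (EuclideanSpace.basisFun (Fin n) ℝ).toBasis]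
    simp only [Fintype.card_fin, Nat.one_lt_cast]
    omega

/-- The shell retracts radially onto the sphere of radius `R + 1`. -/
theorem isSimplyConnected_lt_norm {n : ℕ} (hn : 2 ≤ n) {R : ℝ} (hR : 0 ≤ R) :
    IsSimplyConnected {x : EuclideanSpace ℝ (Fin (n + 1)) | R < ‖x‖} := by
  have := simplyConnectedSpace_stdSphere hn
  have hpos : ∀ x : {x : EuclideanSpace ℝ (Fin (n + 1)) | R < ‖x‖}, 0 < ‖(x : EuclideanSpace ℝ (Fin (n + 1)))‖ :=
    fun x ↦ hR.trans_lt x.2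
  have hcont : Continuous fun x : {x : EuclideanSpace ℝ (Fin (n + 1)) | R < ‖x‖} ↦
      ‖(x : EuclideanSpace ℝ (Fin (n + 1)))‖⁻¹ :=
    Continuous.inv₀ (by fun_prop) fun x ↦ (hpos x).ne'
  let f : C({x : EuclideanSpace ℝ (Fin (n + 1)) | R < ‖x‖}, StdSphere n) :=
    ⟨fun x ↦ ⟨‖(x : EuclideanSpace ℝ (Fin (n + 1)))‖⁻¹ • x, by
      simp [norm_smul, (hpos x).ne']⟩, by fun_prop⟩
  let g : C(StdSphere n, {x : EuclideanSpace ℝ (Fin (n + 1)) | R < ‖x‖}) :=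
    ⟨fun x ↦ ⟨(R + 1) • x, by
      have : ‖(R + 1) • (x : EuclideanSpace ℝ (Fin (n + 1)))‖ = R + 1 := by
        rw [norm_smul, norm_eq_of_mem_sphere, mul_one, Real.norm_of_nonneg (by linarith)]
      simp only [mem_ofPred_eq, this]
      linarith⟩, by fun_prop⟩
  have hfg : f.comp g = .id _ := by
    ext1 x
    apply Subtype.ext
    simp only [f, g, ContinuousMap.comp_apply, ContinuousMap.coe_mk, norm_smul,
      norm_eq_of_mem_sphere, mul_one, ContinuousMap.id_apply, smul_smul]
    rw [Real.norm_of_nonneg (by linarith), inv_mul_cancel₀ (by linarith), one_smul]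
  -- The homotopy runs along rays: the norm at time `t` is `(1 - t)(R + 1) + t‖x‖`, which exceeds
  -- `R` throughout.
  let F : (g.comp f).Homotopy (.id _) :=
    { toFun := fun p ↦ ⟨((1 - (p.1 : ℝ)) * (R + 1) * ‖(p.2 : EuclideanSpace ℝ (Fin (n + 1)))‖⁻¹ +
          p.1) • p.2, by
        have h2 := hpos p.2
        have h3 : R < ‖(p.2 : EuclideanSpace ℝ (Fin (n + 1)))‖ := p.2.2
        have h0 := p.1.2.1
        have h1 := p.1.2.2
        rw [mem_ofPred_eq, norm_smul, Real.norm_of_nonneg (by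
          have : 0 ≤ 1 - (p.1 : ℝ) := by linarith
          positivity), add_mul, inv_mul_cancel_right₀ h2.ne']
        rcases h0.eq_or_lt with h | h
        · rw [← h]
          linarith
        · nlinarith [mul_pos h (sub_pos.2 h3)]⟩
      continuous_toFun := by
        have := hcont.comp (continuous_snd (X := unitInterval))
        simp only [Function.comp_def] at this
        fun_prop
      map_zero_left := fun x ↦ by
        apply Subtype.ext
        simp [f, g, smul_smul]
      map_one_left := fun x ↦ by
        apply Subtype.ext
        simp }
  exact ContinuousMap.HomotopyEquiv.simplyConnectedSpace
    ⟨f, g, ⟨F⟩, hfg ▸ ContinuousMap.Homotopic.refl _⟩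

/-! ### Complements of compact sets in a chart -/

section ComplementOfCompact

variable {T : Type*} [TopologicalSpace T] [T2Space T] {n : ℕ}
  {j : EuclideanSpace ℝ (Fin (n + 1)) → T}

/-- The complement of a ball in a chart of a simply connected manifold is simply connected. -/
theorem isSimplyConnected_compl_image_closedBall [SimplyConnectedSpace T] (hn : 2 ≤ n)
    (hj : IsOpenEmbedding j) {R : ℝ} (hR : 0 ≤ R) :
    IsSimplyConnected (j '' Metric.closedBall 0 R)ᶜ := by
  set B := j '' Metric.closedBall 0 R
  have hB : IsOpen Bᶜ := ((isCompact_closedBall _ _).image hj.continuous).isClosed.isOpen_compl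
  have hcov : Bᶜ ∪ range j = univ := by
    rw [← compl_subset_iff_union, compl_compl]
    exact image_subset_range _ _
  have hint : Bᶜ ∩ range j = j '' {x | R < ‖x‖} := by
    rw [inter_comm, ← sdiff_eq, ← image_compl_eq_range_sdiff_image hj.injective]
    congr 1
    ext x
    simp
  have hint' : IsSimplyConnected (Bᶜ ∩ range j) := by
    rw [hint, hj.isEmbedding.isSimplyConnected_image]
    exact isSimplyConnected_lt_norm hn hR
  have hj' : IsSimplyConnected (range j) := by
    rw [← image_univ, hj.isEmbedding.isSimplyConnected_image]
    exact isSimplyConnected_univ_of_contractible _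
  have hpc : IsPathConnected Bᶜ :=
    .of_union_of_inter hB hj.isOpen_range hcov hint'.isPathConnected
  have : PathConnectedSpace (Bᶜ : Set T) := isPathConnected_iff_pathConnectedSpace.1 hpc
  refine simply_connected_iff_paths_homotopic'.2 ⟨this, fun p q ↦ ?_⟩
  -- Any two paths are homotopic in `T`; injectivity for the cover by `Bᶜ` and the chart moves the
  -- homotopy off `B`.
  exact Path.Homotopic.Quotient.eq.1 <| quotient_mk_eq_of_map_homotopic hB hj.isOpen_range hcov
    hint'.preimage_subtypeVal p q (SimplyConnectedSpace.paths_homotopic _ _)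

/-- Restriction of an embedding to the complement of a set. -/
def complRestrict {E T : Type*} {j : E → T} (hj : Function.Injective j) (C : Set E) :
    (Cᶜ : Set E) → ((j '' C)ᶜ : Set T) :=
  fun x ↦ ⟨j x, fun h ↦ x.2 ((hj.mem_set_image).1 h)⟩

theorem isOpenEmbedding_complRestrict {E T : Type*} [TopologicalSpace E] [TopologicalSpace T]
    {j : E → T} (hj : IsOpenEmbedding j) (C : Set E) :
    IsOpenEmbedding (complRestrict hj.injective C) := by
  refine ⟨.of_comp (by unfold complRestrict; have := hj.continuous; fun_prop)
    continuous_subtype_val (hj.isEmbedding.comp .subtypeVal), ?_⟩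
  have : range (complRestrict hj.injective C) = Subtype.val ⁻¹' (range j) := by
    ext ⟨y, hy⟩
    constructor
    · rintro ⟨x, hx⟩
      exact ⟨x, congrArg Subtype.val hx⟩
    · rintro ⟨x, rfl⟩
      exact ⟨⟨x, fun h ↦ hy (mem_image_of_mem j h)⟩, rfl⟩
  rw [this]
  exact hj.isOpen_range.preimage continuous_subtype_val

/-- In a simply connected manifold, the complement of a compact subset of a chart has the same
fundamental group as its complement within the chart. -/
theorem compl_image_fundamentalGroup [SimplyConnectedSpace T] (hn : 2 ≤ n)
    (hj : IsOpenEmbedding j) {C : Set (EuclideanSpace ℝ (Fin (n + 1)))} (hC : IsCompact C) :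
    (PathConnectedSpace (Cᶜ : Set _) ↔ PathConnectedSpace ((j '' C)ᶜ : Set T)) ∧
    ∀ [PathConnectedSpace (Cᶜ : Set _)] [PathConnectedSpace ((j '' C)ᶜ : Set T)]
      (x : (Cᶜ : Set _)) (y : ((j '' C)ᶜ : Set T)),
      Nonempty (FundamentalGroup (Cᶜ : Set _) x ≃* FundamentalGroup ((j '' C)ᶜ : Set T) y) := by
  obtain ⟨R, hR, hCR⟩ : ∃ R : ℝ, 0 ≤ R ∧ C ⊆ Metric.closedBall 0 R := by
    obtain ⟨R, hR⟩ := hC.isBounded.subset_closedBall 0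
    exact ⟨max R 0, le_max_right _ _, hR.trans (Metric.closedBall_subset_closedBall (le_max_left _ _))⟩
  set B := j '' Metric.closedBall 0 R with hBdef
  have hi := isOpenEmbedding_complRestrict hj C
  have hB : IsOpen Bᶜ := ((isCompact_closedBall _ _).image hj.continuous).isClosed.isOpen_compl
  have hBC : Bᶜ ⊆ (j '' C)ᶜ := compl_subset_compl.2 (image_mono hCR)
  let V : Set ((j '' C)ᶜ : Set T) := Subtype.val ⁻¹' Bᶜ
  have hV : IsOpen V := hB.preimage continuous_subtype_val
  have hcov : range (complRestrict hj.injective C) ∪ V = univ := by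
    rw [eq_univ_iff_forall]
    rintro ⟨y, hy⟩
    by_cases hyB : y ∈ B
    · obtain ⟨x, -, rfl⟩ := hyB
      exact .inl ⟨⟨x, fun h ↦ hy (mem_image_of_mem j h)⟩, rfl⟩
    · exact .inr hyB
  have hVsc : IsSimplyConnected V := by
    apply IsSimplyConnected.preimage_subtypeVal
    rw [inter_eq_right.2 hBC]
    exact isSimplyConnected_compl_image_closedBall hn hj hR
  have hint : IsSimplyConnected (range (complRestrict hj.injective C) ∩ V) := by
    rw [← (IsEmbedding.subtypeVal (p := (· ∈ (j '' C)ᶜ))).isSimplyConnected_image]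
    have : Subtype.val '' (range (complRestrict hj.injective C) ∩ V) = j '' {x | R < ‖x‖} := by
      ext y
      constructor
      · rintro ⟨_, ⟨⟨x, rfl⟩, hx⟩, rfl⟩
        refine ⟨x, ?_, rfl⟩
        by_contra h
        exact hx ⟨x, by simpa using h, rfl⟩
      · rintro ⟨x, hx, rfl⟩
        have hxB : j x ∉ B := fun h ↦ by
          have := (hj.injective.mem_set_image).1 h
          simp only [Metric.mem_closedBall, dist_zero_right] at this
          exact absurd hx this.not_gt
        exact ⟨⟨j x, hBC hxB⟩, ⟨⟨⟨x, fun h ↦ hBC hxB (mem_image_of_mem j h)⟩, rfl⟩, hxB⟩, rfl⟩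
    rw [this, hj.isEmbedding.isSimplyConnected_image]
    exact isSimplyConnected_lt_norm hn hR
  exact ⟨hi.pathConnectedSpace_iff hV hcov hVsc.isPathConnected hint.isPathConnected,
    fun x y ↦ hi.nonempty_fundamentalGroup_mulEquiv hV hcov hVsc hint x y⟩

end ComplementOfCompact

/-! ### Transport of charts -/

section ChartTransfer

/-- Transport of a chart along a correspondence given by two open embeddings of a space `Z`. -/
theorem exists_chart_transfer {Z M N H : Type*} [TopologicalSpace Z] [TopologicalSpace M]
    [TopologicalSpace N] [TopologicalSpace H] {a : Z → M} {b : Z → N} (ha : IsOpenEmbedding a)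
    (hb : IsOpenEmbedding b) (φ : OpenPartialHomeomorph N H) (z : Z) (hz : b z ∈ φ.source) :
    ∃ φ' : OpenPartialHomeomorph M H, a z ∈ φ'.source ∧
      ∀ y ∈ φ'.source, ∃ w, a w = y ∧ b w ∈ φ.source ∧ φ' y = φ (b w) := by
  have : Nonempty Z := ⟨z⟩
  have hinv : ∀ w, (ha.toOpenPartialHomeomorph a).symm (a w) = w := fun w ↦
    ha.toOpenPartialHomeomorph_left_inv
  refine ⟨((ha.toOpenPartialHomeomorph a).symm.trans (hb.toOpenPartialHomeomorph b)).trans φ,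
    ?_, ?_⟩
  · simp [hinv, hz]
  · intro y hy
    simp only [OpenPartialHomeomorph.trans_source, mem_inter_iff] at hy
    obtain ⟨⟨hy1, -⟩, hy2⟩ := hy
    simp only [OpenPartialHomeomorph.symm_source, IsOpenEmbedding.toOpenPartialHomeomorph_target]
      at hy1
    obtain ⟨w, rfl⟩ := hy1
    refine ⟨w, rfl, ?_, ?_⟩
    · simpa [hinv] using hy2
    · simp [hinv]

/-- By `hA` both sets cut out the same subset of `E`, which serves as the common source of the two
restricted embeddings. -/
theorem exists_chart_transfer_subtype {E S X H : Type*} [TopologicalSpace E] [TopologicalSpace S]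
    [TopologicalSpace X] [TopologicalSpace H] {g : E → S} {j : E → X} (hg : IsOpenEmbedding g)
    (hj : IsOpenEmbedding j) {A : Set S} {A' : Set X} (hA : j ⁻¹' A' = g ⁻¹' A) (z : E)
    (hz : g z ∈ A) (hz' : j z ∈ A') (φ : OpenPartialHomeomorph A H)
    (hφ : (⟨g z, hz⟩ : A) ∈ φ.source) :
    ∃ φ' : OpenPartialHomeomorph A' H, (⟨j z, hz'⟩ : A') ∈ φ'.source ∧
      ∀ y ∈ φ'.source, ∃ (w : E) (hw : g w ∈ A), j w = y ∧ (⟨g w, hw⟩ : A) ∈ φ.source ∧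
        φ' y = φ ⟨g w, hw⟩ := by
  have hb : IsOpenEmbedding (A.restrictPreimage g) := hg.restrictPreimage A
  have ha : IsOpenEmbedding (A'.restrictPreimage j ∘ Homeomorph.setCongr hA.symm) :=
    (hj.restrictPreimage A').comp (Homeomorph.setCongr hA.symm).isOpenEmbedding
  obtain ⟨φ', h1, h2⟩ := exists_chart_transfer ha hb φ ⟨z, hz⟩ hφ
  refine ⟨φ', h1, fun y hy ↦ ?_⟩
  obtain ⟨w, rfl, hw, hw'⟩ := h2 y hy
  exact ⟨w, w.2, rfl, hw, hw'⟩

/-- The chart of the open half-space `0 < x 0` in the half-space. -/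
noncomputable def openHalfSpaceChart :
    OpenPartialHomeomorph (EuclideanSpace ℝ (Fin 4)) (EuclideanHalfSpace 4) where
  toFun := (modelWithCornersEuclideanHalfSpace 4).symm
  invFun := modelWithCornersEuclideanHalfSpace 4
  source := {x | 0 < x 0}
  target := {x | 0 < x.1 0}
  map_source' x hx := by
    change 0 < (modelWithCornersEuclideanHalfSpace 4
      ((modelWithCornersEuclideanHalfSpace 4).symm x)) 0
    rw [ModelWithCorners.right_inv]
    · exact hx
    · rw [range_modelWithCornersEuclideanHalfSpace]
      exact le_of_lt (show (0 : ℝ) < x 0 from hx)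
  map_target' x hx := hx
  left_inv' x hx := by
    rw [ModelWithCorners.right_inv]
    rw [range_modelWithCornersEuclideanHalfSpace]
    exact le_of_lt (show (0 : ℝ) < x 0 from hx)
  right_inv' x _ := ModelWithCorners.left_inv _ x
  open_source := isOpen_lt continuous_const (by fun_prop)
  open_target := isOpen_lt continuous_const (by
    have := (modelWithCornersEuclideanHalfSpace 4).continuous
    change Continuous fun x ↦ (modelWithCornersEuclideanHalfSpace 4 x) 0
    fun_prop)
  continuousOn_toFun := (ModelWithCorners.continuous_symm _).continuousOn
  continuousOn_invFun := (ModelWithCorners.continuous _).continuousOn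

theorem exists_interior_chart {X : Type*} [TopologicalSpace X]
    [ChartedSpace (EuclideanSpace ℝ (Fin 4)) X] {A O : Set X} (hO : IsOpen O) (hOA : O ⊆ A)
    {x : X} (hx : x ∈ O) :
    ∃ φ : OpenPartialHomeomorph A (EuclideanHalfSpace 4), (⟨x, hOA hx⟩ : A) ∈ φ.source ∧
      ∀ y ∈ φ.source, (y : X) ∈ O ∧ 0 < (φ y).1 0 := by
  let c : OpenPartialHomeomorph X (EuclideanSpace ℝ (Fin 4)) := chartAt _ x
  -- This translation moves the image of `x` to height `1`, inside the open half-space.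
  let v : EuclideanSpace ℝ (Fin 4) := EuclideanSpace.single 0 1 - c x
  let φ : OpenPartialHomeomorph X (EuclideanHalfSpace 4) :=
    (c.transHomeomorph (Homeomorph.addRight v)).trans openHalfSpaceChart
  have hxφ : x ∈ φ.source := by
    refine ⟨mem_chart_source _ x, ?_⟩
    change 0 < (c x + v) 0
    simp [v]
  have ha : IsOpenEmbedding (inclusion hOA) := .inclusion hOA (hO.preimage continuous_subtype_val)
  obtain ⟨φ', h1, h2⟩ := exists_chart_transfer ha hO.isOpenEmbedding_subtypeVal φ ⟨x, hx⟩ hxφ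
  refine ⟨φ', h1, fun y hy ↦ ?_⟩
  obtain ⟨w, rfl, hw, hw'⟩ := h2 y hy
  refine ⟨w.2, ?_⟩
  rw [hw']
  exact φ.map_source hw |>.1

end ChartTransfer

/-! ### Orientability and genus as homeomorphism invariants -/

section Homeomorphism

variable {F F' : Type*} [TopologicalSpace F] [TopologicalSpace F']

theorem HasMoebiusBand.of_homeomorph (e : F ≃ₜ F') (h : HasMoebiusBand F) : HasMoebiusBand F' := by
  obtain ⟨m, hm, hm'⟩ := h
  refine ⟨e ∘ m, e.continuous.comp_continuousOn hm, fun p hp q hq ↦ ?_⟩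
  rw [← hm' p hp q hq]
  exact e.injective.eq_iff

theorem OrientableSurface.of_homeomorph (e : F ≃ₜ F') (h : OrientableSurface F) :
    OrientableSurface F' :=
  fun h' ↦ h (h'.of_homeomorph e.symm)

theorem HasNonseparatingCurves.of_homeomorph (e : F ≃ₜ F') {k : ℕ}
    (h : HasNonseparatingCurves F k) : HasNonseparatingCurves F' k := by
  obtain ⟨γ, h1, h2, h3⟩ := h
  refine ⟨fun i ↦ e ∘ γ i, fun i ↦ e.isEmbedding.comp (h1 i), fun i i' hi ↦ ?_, ?_⟩
  · rw [range_comp, range_comp, disjoint_image_iff e.injective]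
    exact h2 i i' hi
  · have : (⋃ i, range (e ∘ γ i))ᶜ = e '' (⋃ i, range (γ i))ᶜ := by
      rw [image_compl_eq e.bijective, image_iUnion]
      simp only [range_comp]
    rw [this]
    exact h3.image e e.continuous.continuousOn

theorem surfaceGenus_congr (e : F ≃ₜ F') : surfaceGenus F = surfaceGenus F' := by
  unfold surfaceGenus
  congr! 3 with k
  exact ⟨fun h ↦ h.of_homeomorph e, fun h ↦ h.of_homeomorph e.symm⟩

end Homeomorphism

/-! ### Transport of sets, manifolds and proper surfaces -/

section Push

/-- Transport of a set along two maps from the same space. -/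
def pushSet {E S X : Type*} (g : E → S) (j : E → X) (P : Set S) : Set X := j '' (g ⁻¹' P)

theorem preimage_pushSet {E S X : Type*} (g : E → S) {j : E → X} (hj : Function.Injective j)
    (P : Set S) : j ⁻¹' pushSet g j P = g ⁻¹' P :=
  preimage_image_eq _ hj

theorem mem_pushSet {E S X : Type*} {g : E → S} {j : E → X} (hj : Function.Injective j)
    {P : Set S} {z : E} : j z ∈ pushSet g j P ↔ g z ∈ P :=
  hj.mem_set_image

theorem pushSet_union {E S X : Type*} (g : E → S) (j : E → X) (P Q : Set S) :
    pushSet g j (P ∪ Q) = pushSet g j P ∪ pushSet g j Q :=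
  image_union _ _ _

variable {E S X : Type*} [TopologicalSpace E] [TopologicalSpace S] [TopologicalSpace X]
  {g : E → S} {j : E → X}

/-- The homeomorphism between a set and its transport. -/
noncomputable def homeomorphPushSet (hg : IsOpenEmbedding g) (hj : IsOpenEmbedding j) {P : Set S}
    (hP : P ⊆ range g) : P ≃ₜ pushSet g j P :=
  ((Homeomorph.setCongr (image_preimage_eq_of_subset hP).symm).trans
    (hg.isEmbedding.homeomorphImage (g ⁻¹' P)).symm).trans
      (hj.isEmbedding.homeomorphImage (g ⁻¹' P))

theorem isCompact_pushSet (hg : IsOpenEmbedding g) (hj : IsOpenEmbedding j) {P : Set S}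
    (hP : P ⊆ range g) (h : IsCompact P) : IsCompact (pushSet g j P) := by
  rw [isCompact_iff_compactSpace] at h ⊢
  exact (homeomorphPushSet hg hj hP).compactSpace

theorem isConnected_pushSet (hg : IsOpenEmbedding g) (hj : IsOpenEmbedding j) {P : Set S}
    (hP : P ⊆ range g) (h : IsConnected P) : IsConnected (pushSet g j P) := by
  rw [isConnected_iff_connectedSpace] at h ⊢
  exact (homeomorphPushSet hg hj hP).surjective.connectedSpace
    (homeomorphPushSet hg hj hP).continuous

theorem IsFourManifoldWithBoundary.exists_chart_push (hg : IsOpenEmbedding g)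
    (hj : IsOpenEmbedding j) {A B : Set S} {A' B' : Set X} (h : IsFourManifoldWithBoundary A B)
    (hA : j ⁻¹' A' = g ⁻¹' A) (hB : j ⁻¹' B' = g ⁻¹' B) (x : A') (hx : (x : X) ∈ range j) :
    ∃ φ : OpenPartialHomeomorph A' (EuclideanHalfSpace 4),
      x ∈ φ.source ∧ ∀ y ∈ φ.source, (y : X) ∈ B' ↔ (φ y).1 0 = 0 := by
  obtain ⟨_, hx'⟩ := x
  obtain ⟨z, rfl⟩ := hx
  have hz : g z ∈ A := by rwa [← mem_preimage, hA] at hx'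
  obtain ⟨φ, h1, h2⟩ := h.exists_chart ⟨g z, hz⟩
  obtain ⟨φ', h3, h4⟩ := exists_chart_transfer_subtype hg hj hA z hz hx' φ h1
  refine ⟨φ', h3, fun y hy ↦ ?_⟩
  obtain ⟨w, hw, hwy, hws, hφ⟩ := h4 y hy
  rw [hφ, ← h2 _ hws, ← hwy, ← mem_preimage, hB, mem_preimage]

/-- As `F` lies in the range of `g`, every condition is either intrinsic to `F` or local at points
of the chart. -/
theorem IsProperSurface.push (hg : IsOpenEmbedding g) (hj : IsOpenEmbedding j) {A B C F : Set S}
    {A' B' : Set X} (h : IsProperSurface A B C F) (hF : F ⊆ range g)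
    (hA : j ⁻¹' A' = g ⁻¹' A) (hB : j ⁻¹' B' = g ⁻¹' B) :
    IsProperSurface A' B' (pushSet g j C) (pushSet g j F) where
  subset := by
    rintro _ ⟨z, hz, rfl⟩
    rw [← mem_preimage, hA]
    exact h.subset hz
  isCompact := isCompact_pushSet hg hj hF h.isCompact
  isConnected := isConnected_pushSet hg hj hF h.isConnected
  orientable := h.orientable.of_homeomorph (homeomorphPushSet hg hj hF)
  inter_boundary := by
    rw [pushSet, ← image_inter_preimage, hB, ← preimage_inter, h.inter_boundary]
    rfl
  locallyFlat := by
    rintro ⟨_, hx'⟩ ⟨z, hzF, rfl⟩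
    have hz : g z ∈ A := h.subset hzF
    obtain ⟨φ, h1, h2, h2'⟩ := h.locallyFlat ⟨g z, hz⟩ hzF
    obtain ⟨φ', h3, h4⟩ := exists_chart_transfer_subtype hg hj hA z hz hx' φ h1
    refine ⟨φ', h3, fun y hy ↦ ?_, fun y hy ↦ ?_⟩
    · obtain ⟨w, hw, hwy, hws, hφ⟩ := h4 y hy
      rw [hφ, ← h2 _ hws, ← hwy, ← mem_preimage, hB, mem_preimage]
    · obtain ⟨w, hw, hwy, hws, hφ⟩ := h4 y hy
      rw [hφ, ← h2' _ hws, ← hwy, mem_pushSet hj.injective]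

end Push

/-! ### Transport of ℤ-surfaces -/

section ZSurface

variable {S X : Type*} [TopologicalSpace S] [TopologicalSpace X] [T2Space S] [T2Space X]
  [SimplyConnectedSpace S] [SimplyConnectedSpace X]
  {g : EuclideanSpace ℝ (Fin 4) → S} {j : EuclideanSpace ℝ (Fin 4) → X}

/-- Both complements have the fundamental group of the complement of `g ⁻¹' F` in `ℝ⁴`. -/
theorem IsZSurface.push (hg : IsOpenEmbedding g) (hj : IsOpenEmbedding j) {F : Set S}
    (h : IsZSurface F) (hF : F ⊆ range g) : IsZSurface (pushSet g j F) := by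
  have hFC : g '' (g ⁻¹' F) = F := image_preimage_eq_of_subset hF
  have hC : IsCompact (g ⁻¹' F) := by
    rw [hg.isEmbedding.isCompact_iff, hFC]
    exact h.isCompact
  have hS := compl_image_fundamentalGroup (by norm_num) hg hC
  have hX := compl_image_fundamentalGroup (by norm_num) hj hC
  rw [hFC] at hS
  have i1 := h.pathConnected_compl
  have i2 := hS.1.2 i1
  have i3 := hX.1.1 i2
  refine ⟨isCompact_pushSet hg hj hF h.isCompact, isConnected_pushSet hg hj hF h.isConnected,
    h.orientable.of_homeomorph (homeomorphPushSet hg hj hF), ?_, i3, fun y ↦ ?_⟩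
  · rintro _ ⟨z, hz, rfl⟩
    obtain ⟨φ, h1, h2⟩ := h.locallyFlat (g z) hz
    obtain ⟨φ', h3, h4⟩ := exists_chart_transfer hj hg φ z h1
    refine ⟨φ', h3, fun y hy ↦ ?_⟩
    obtain ⟨w, rfl, hws, hφ⟩ := h4 y hy
    rw [hφ, ← h2 _ hws, mem_pushSet hj.injective]
  · obtain ⟨x⟩ := i2.nonempty
    obtain ⟨s⟩ := i1.nonempty
    obtain ⟨e1⟩ := hX.2 x y
    obtain ⟨e2⟩ := hS.2 x s
    obtain ⟨e3⟩ := h.fundamentalGroup_compl s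
    exact ⟨(e1.symm.trans e2).trans e3⟩

end ZSurface

/-- A nonempty manifold has an embedding of the whole Euclidean space as an open subset. -/
theorem exists_isOpenEmbedding_euclideanSpace {n : ℕ} (X : Type*) [TopologicalSpace X] [Nonempty X]
    [ChartedSpace (EuclideanSpace ℝ (Fin n)) X] :
    ∃ j : EuclideanSpace ℝ (Fin n) → X, IsOpenEmbedding j := by
  obtain ⟨x⟩ := ‹Nonempty X›
  let c : OpenPartialHomeomorph X (EuclideanSpace ℝ (Fin n)) := chartAt _ x
  obtain ⟨r, hr, hball⟩ := Metric.isOpen_iff.1 c.open_target (c x)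
    (c.map_source (mem_chart_source _ x))
  -- A small ball in the target of the chart is itself a copy of the whole Euclidean space.
  let u : OpenPartialHomeomorph (EuclideanSpace ℝ (Fin n)) (EuclideanSpace ℝ (Fin n)) :=
    OpenPartialHomeomorph.univBall (c x) r
  refine ⟨u.trans c.symm, (u.trans c.symm).isOpenEmbedding ?_⟩
  rw [OpenPartialHomeomorph.trans_source, OpenPartialHomeomorph.univBall_source, univ_inter,
    eq_univ_iff_forall]
  intro y
  apply hball
  have := u.map_source (x := y) (by simp [u])
  rwa [OpenPartialHomeomorph.univBall_target _ hr] at this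

/-- A proper surface in a manifold with boundary misses some interior point of the manifold. -/
theorem IsProperSurface.exists_notMem {X : Type*} [TopologicalSpace X] {A B C F : Set X}
    (h : IsProperSurface A B C F) : ∃ p ∈ A, p ∉ B ∧ p ∉ F := by
  obtain ⟨x, hx⟩ := h.isConnected.nonempty
  obtain ⟨φ, h1, h2, h3⟩ := h.locallyFlat ⟨x, h.subset hx⟩ hx
  set q := φ ⟨x, h.subset hx⟩
  have hq : q ∈ φ.target := φ.map_source h1
  -- The direction `e₀` leaves the boundary and `e₂` leaves the surface; `|t|` keeps the curve in
  -- the half-space for all `t`.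
  let c : ℝ → EuclideanHalfSpace 4 := fun t ↦
    ⟨q.1 + |t| • (EuclideanSpace.single 0 1 + EuclideanSpace.single 2 1), by
      have := q.2
      simp
      positivity⟩
  have hc : Continuous c := Continuous.subtype_mk (by fun_prop) _
  have hc0 : c 0 = q := Subtype.ext (by simp [c])
  have hq2 : q.1 2 = 0 := ((h3 _ h1).1 hx).1
  have hev : ∀ᶠ t in 𝓝 (0 : ℝ), c t ∈ φ.target :=
    hc.continuousAt.eventually (by rw [hc0]; exact φ.open_target.mem_nhds hq)
  obtain ⟨t, ht, ht0⟩ : ∃ t, c t ∈ φ.target ∧ 0 < t := by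
    have := (hev.filter_mono nhdsWithin_le_nhds).and (self_mem_nhdsWithin (a := (0 : ℝ)) (s := Ioi 0))
    exact this.exists
  refine ⟨φ.symm (c t), (φ.symm (c t)).2, fun hB ↦ ?_, fun hF ↦ ?_⟩
  · have := (h2 _ (φ.map_target ht)).1 hB
    rw [φ.right_inv ht] at this
    have hq0 := q.2
    simp [c] at this
    have : 0 < |t| := abs_pos.2 ht0.ne'
    linarith
  · have := ((h3 _ (φ.map_target ht)).1 hF).1
    rw [φ.right_inv ht] at this
    simp [c, hq2] at this
    exact ht0.ne' this

/-! ### Connectedness of the new first piece -/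

section Complement

variable {S X : Type*} [TopologicalSpace S] [TopologicalSpace X] [T2Space S] [T2Space X]
  [ConnectedSpace X] {n : ℕ}
  {g : EuclideanSpace ℝ (Fin (n + 1)) → S} {j : EuclideanSpace ℝ (Fin (n + 1)) → X} {p : S}
  {A B : Set S}

/-- Let `S = A ∪ B` with `B` compact and missing the point `p` at infinity of `g`. If `u` and `v`
are closed, disjoint and cover the complement of the transport of `Aᶜ`, and `u` contains the points near infinity,
then `u` contains everything. -/
theorem compl_pushSet_subset_of_near_infinity (hg : IsOpenEmbedding g) (hj : IsOpenEmbedding j)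
    (hgp : range g = {p}ᶜ) (hA : IsPreconnected A) (hAc : IsClosed A) (hB : IsCompact (g ⁻¹' B))
    (hAB : A ∪ B = univ) (hp : p ∉ B) {R : ℝ} {u v : Set X} (hu : IsClosed u) (hv : IsClosed v)
    (huv : (pushSet g j Aᶜ)ᶜ ⊆ u ∪ v) (hd : Disjoint u v)
    (hinf : j '' {x | R < ‖x‖} ⊆ u) : (pushSet g j Aᶜ)ᶜ ⊆ u := by
  have hmem : ∀ z, g z ∈ A → j z ∈ u ∪ v := fun z hz ↦ huv fun h ↦
    (mem_pushSet hj.injective).1 h hz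
  have hpA : p ∈ A := (hAB ▸ mem_univ p : p ∈ A ∪ B).resolve_right hp
  -- The separation is carried back to `S`, with `p` and its surroundings put on the side of `u`.
  -- The radii `R` and `R + 1` keep both sets closed and disjoint.
  let u₀ : Set S := (g '' Metric.ball 0 (R + 1))ᶜ ∪ g '' (j ⁻¹' u ∩ Metric.closedBall 0 (R + 1))
  let v₀ : Set S := g '' (j ⁻¹' v ∩ Metric.closedBall 0 R)
  have hu₀ : IsClosed u₀ := by
    refine .union (hg.isOpenMap _ Metric.isOpen_ball).isClosed_compl ?_
    exact (((isCompact_closedBall _ _).inter_left (hu.preimage hj.continuous)).image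
      hg.continuous).isClosed
  have hv₀ : IsClosed v₀ :=
    (((isCompact_closedBall _ _).inter_left (hv.preimage hj.continuous)).image
      hg.continuous).isClosed
  have hpu : p ∈ u₀ := by
    refine .inl fun h ↦ ?_
    have : p ∈ range g := image_subset_range _ _ h
    rw [hgp] at this
    exact this rfl
  have hfar : ∀ z, R < ‖z‖ → j z ∈ u := fun z hz ↦ hinf (mem_image_of_mem j hz)
  have hcov : A ⊆ u₀ ∪ v₀ := by
    intro s hs
    by_cases hsp : s = p
    · exact .inl (hsp ▸ hpu)
    · obtain ⟨z, rfl⟩ : s ∈ range g := by rw [hgp]; exact hsp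
      rcases lt_or_ge R ‖z‖ with hz | hz
      · by_cases hz' : z ∈ Metric.ball (0 : EuclideanSpace ℝ (Fin (n + 1))) (R + 1)
        · exact .inl (.inr ⟨z, ⟨hfar z hz, Metric.ball_subset_closedBall hz'⟩, rfl⟩)
        · exact .inl (.inl fun h ↦ hz' (hg.injective.mem_set_image.1 h))
      · rcases hmem z hs with h | h
        · exact .inl (.inr ⟨z, ⟨h, by simpa using by linarith⟩, rfl⟩)
        · exact .inr ⟨z, ⟨h, by simpa using hz⟩, rfl⟩
  have hdisj : Disjoint u₀ v₀ := by
    rw [disjoint_left]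
    rintro _ hs ⟨z, ⟨hzv, hz⟩, rfl⟩
    rcases hs with hs | hs
    · refine hs (mem_image_of_mem g ?_)
      simp only [Metric.mem_closedBall, Metric.mem_ball] at hz ⊢
      linarith
    · exact disjoint_left.1 hd (hg.injective.mem_set_image.1 hs).1 hzv
  have hAu : A ⊆ u₀ := by
    refine ((isPreconnected_iff_subset_of_fully_disjoint_closed hAc).1 hA u₀ v₀ hu₀ hv₀ hcov
      hdisj).resolve_right fun h ↦ ?_
    exact disjoint_left.1 hdisj hpu (h hpA)
  have hrange : ∀ z, g z ∈ A → j z ∈ u := by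
    intro z hz
    rcases hmem z hz with h | h
    · exact h
    rcases lt_or_ge R ‖z‖ with hz' | hz'
    · exact hfar z hz'
    · have hzv : g z ∈ v₀ := ⟨z, ⟨h, by simpa using hz'⟩, rfl⟩
      exact absurd hzv (disjoint_left.1 hdisj (hAu hz))
  -- the part of `v` in the complement is open and closed
  let w : Set X := v \ pushSet g j Aᶜ
  have hw : IsClosed w := by
    have : IsOpen (pushSet g j Aᶜ) := hj.isOpenMap _ (hAc.isOpen_compl.preimage hg.continuous)
    exact hv.inter this.isClosed_compl
  have hBj : IsClosed (j '' (g ⁻¹' B)) := (hB.image hj.continuous).isClosed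
  have hAcB : pushSet g j Aᶜ ⊆ j '' (g ⁻¹' B) := image_mono <| preimage_mono fun s hs ↦
    (hAB ▸ mem_univ s : s ∈ A ∪ B).resolve_left hs
  -- Points of the chart coming from `A` are in `u` and the others are removed, so `w` is also the
  -- complement of a closed set.
  have hw' : w = (u ∪ j '' (g ⁻¹' B))ᶜ := by
    ext x
    constructor
    · rintro ⟨hxv, hx⟩ (hxu | ⟨z, hz, rfl⟩)
      · exact disjoint_left.1 hd hxu hxv
      · have : g z ∈ A := by
          by_contra h
          exact hx ((mem_pushSet hj.injective).2 h)
        exact disjoint_left.1 hd (hrange z this) hxv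
    · intro hx
      have hx' : x ∉ pushSet g j Aᶜ := fun h ↦ hx (.inr (hAcB h))
      exact ⟨(huv hx').resolve_left fun h ↦ hx (.inl h), hx'⟩
  have hwclopen : IsClopen w := ⟨hw, hw' ▸ (hu.union hBj).isOpen_compl⟩
  rcases isClopen_iff.1 hwclopen with h | h
  · intro x hx
    refine (huv hx).resolve_right fun hxv ↦ ?_
    exact (h ▸ (⟨hxv, hx⟩ : x ∈ w) : x ∈ (∅ : Set X))
  · have hne : ∃ z : EuclideanSpace ℝ (Fin (n + 1)), R < ‖z‖ := by
      refine ⟨EuclideanSpace.single 0 (|R| + 1), ?_⟩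
      have : ‖(EuclideanSpace.single 0 (|R| + 1) : EuclideanSpace ℝ (Fin (n + 1)))‖ = |R| + 1 := by
        simp [abs_of_nonneg (by positivity : 0 ≤ |R| + 1)]
      rw [this]
      linarith [le_abs_self R]
    obtain ⟨z, hz⟩ := hne
    have hzw : j z ∈ w := h ▸ mem_univ _
    exact absurd hzw.1 (disjoint_left.1 hd (hfar z hz))

/-- Let `S = A ∪ B` with `B` compact and missing the point `p` at infinity of `g`. If `A` is
connected, then replacing a neighbourhood of `p` in `A` by the complement of the chart `j` of
the connected manifold `X` gives a connected set. -/
theorem isConnected_compl_pushSet (hn : 2 ≤ n) (hg : IsOpenEmbedding g) (hj : IsOpenEmbedding j)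
    (hgp : range g = {p}ᶜ) (hA : IsPreconnected A) (hAc : IsClosed A) (hB : IsCompact (g ⁻¹' B))
    (hAB : A ∪ B = univ) (hp : p ∉ B) : IsConnected (pushSet g j Aᶜ)ᶜ := by
  obtain ⟨R, hR0, hR⟩ : ∃ R : ℝ, 0 ≤ R ∧ g ⁻¹' B ⊆ Metric.closedBall 0 R := by
    obtain ⟨R, hR⟩ := hB.isBounded.subset_closedBall 0
    exact ⟨max R 0, le_max_right _ _, hR.trans (Metric.closedBall_subset_closedBall (le_max_left _ _))⟩
  have hD := (isSimplyConnected_lt_norm hn hR0).isPathConnected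
  have hDsub : j '' {x | R < ‖x‖} ⊆ (pushSet g j Aᶜ)ᶜ := by
    rintro _ ⟨z, hz, rfl⟩ h
    have hzA := (mem_pushSet hj.injective).1 h
    have : z ∈ Metric.closedBall 0 R := hR ((hAB ▸ mem_univ (g z) : g z ∈ A ∪ B).resolve_left hzA)
    simp only [Metric.mem_closedBall, dist_zero_right] at this
    exact absurd hz this.not_gt
  refine ⟨(hD.nonempty.image j).mono hDsub, ?_⟩
  have hcl : IsClosed (pushSet g j Aᶜ)ᶜ :=
    (hj.isOpenMap _ (hAc.isOpen_compl.preimage hg.continuous)).isClosed_compl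
  rw [isPreconnected_iff_subset_of_fully_disjoint_closed hcl]
  intro u v hu hv huv hd
  have hDc : IsPreconnected (j '' {x | R < ‖x‖}) :=
    (hD.isConnected.isPreconnected).image _ hj.continuous.continuousOn
  rcases isPreconnected_iff_subset_of_disjoint_closed.1 hDc u v hu hv (hDsub.trans huv)
    (by rw [hd.inter_eq, inter_empty]) with h | h
  · exact .inl (compl_pushSet_subset_of_near_infinity hg hj hgp hA hAc hB hAB hp hu hv huv hd h)
  · exact .inr (compl_pushSet_subset_of_near_infinity hg hj hgp hA hAc hB hAB hp hv hu
      (union_comm u v ▸ huv) hd.symm h)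

end Complement

/-! ### Transport of the splitting -/

section Splitting

variable {S X : Type*} [TopologicalSpace S] [TopologicalSpace X] [T2Space S] [T2Space X]
  [CompactSpace X] [ConnectedSpace X] [ChartedSpace (EuclideanSpace ℝ (Fin 4)) X]
  {g : EuclideanSpace ℝ (Fin 4) → S} {j : EuclideanSpace ℝ (Fin 4) → X} {p : S}

/-- Replacing a neighbourhood of a point `p` in the first piece of a splitting of `S` by the
complement of a chart of the closed manifold `X` gives a splitting of `X`. -/
theorem SphereSplitting.exists_push (D : SphereSplitting S) (hg : IsOpenEmbedding g)
    (hj : IsOpenEmbedding j) (hgp : range g = {p}ᶜ) (hp : p ∉ D.X₂) :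
    ∃ D' : SphereSplitting X, j ⁻¹' D'.X₁ = g ⁻¹' D.X₁ ∧ j ⁻¹' D'.X₂ = g ⁻¹' D.X₂ ∧
      ∀ K : Set (StdSphere 3), D'.e '' K = pushSet g j (D.e '' K) := by
  have hX₂ : D.X₂ ⊆ range g := by
    rw [hgp]
    rintro x hx rfl
    exact hp hx
  have hX₁c : IsClosed D.X₁ := D.manifold₁.isCompact.isClosed
  have hX₂c : IsCompact (g ⁻¹' D.X₂) := by
    rw [hg.isEmbedding.isCompact_iff, image_preimage_eq_of_subset hX₂]
    exact D.manifold₂.isCompact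
  have hE₂ : range D.e ⊆ D.X₂ := D.manifold₂.boundary_subset
  -- The sphere lies in `X₂`, hence misses `p` and lifts to `ℝ⁴`.
  choose γ hγ using fun x ↦ hX₂ (hE₂ (mem_range_self x))
  have hγe : g ∘ γ = D.e := funext hγ
  have hγc : Continuous γ := by
    rw [hg.isInducing.continuous_iff, hγe]
    exact D.isEmbedding.continuous
  have hγemb : IsEmbedding γ := .of_comp hγc hg.continuous (hγe ▸ D.isEmbedding)
  have himage : ∀ K : Set (StdSphere 3), (j ∘ γ) '' K = pushSet g j (D.e '' K) := by
    intro K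
    rw [pushSet, ← hγe, image_comp, image_comp, preimage_image_eq _ hg.injective]
  have hrange : range (j ∘ γ) = pushSet g j (range D.e) := by
    rw [← image_univ, himage, image_univ]
  have h₁ : j ⁻¹' (pushSet g j D.X₁ᶜ)ᶜ = g ⁻¹' D.X₁ := by
    rw [preimage_compl, preimage_pushSet g hj.injective, preimage_compl, compl_compl]
  have h₂ : j ⁻¹' pushSet g j D.X₂ = g ⁻¹' D.X₂ := preimage_pushSet g hj.injective _
  have hB : j ⁻¹' range (j ∘ γ) = g ⁻¹' range D.e := by
    rw [hrange, preimage_pushSet g hj.injective]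
  have hcompl : pushSet g j D.X₁ᶜ ⊆ pushSet g j D.X₂ := image_mono <| preimage_mono fun s hs ↦
    (D.union_eq ▸ mem_univ s : s ∈ D.X₁ ∪ D.X₂).resolve_left hs
  have hclosed : IsClosed (pushSet g j D.X₁ᶜ)ᶜ :=
    (hj.isOpenMap _ (hX₁c.isOpen_compl.preimage hg.continuous)).isClosed_compl
  refine ⟨{
    -- A double complement, so that the part of `X` outside the chart belongs to the first piece.
    X₁ := (pushSet g j D.X₁ᶜ)ᶜ
    X₂ := pushSet g j D.X₂
    e := j ∘ γ
    isEmbedding := hj.isEmbedding.comp hγemb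
    union_eq := ?_
    inter_eq := ?_
    manifold₁ := ⟨hclosed.isCompact, ?_, ?_, ?_⟩
    manifold₂ := ⟨?_, ?_, ?_, ?_⟩ }, h₁, h₂, himage⟩
  · rw [← compl_subset_iff_union, compl_compl]
    exact hcompl
  · rw [hrange, ← D.inter_eq, inter_comm D.X₁, inter_comm,
      show pushSet g j (D.X₂ ∩ D.X₁) = j '' (g ⁻¹' D.X₂ ∩ g ⁻¹' D.X₁) from rfl, ← h₁,
      image_inter_preimage]
    rfl
  · exact isConnected_compl_pushSet (by norm_num) hg hj hgp D.manifold₁.isConnected.isPreconnected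
      hX₁c hX₂c D.union_eq hp
  · rw [hrange]
    rintro _ ⟨z, hz, rfl⟩ h
    exact (mem_pushSet hj.injective).1 h (D.manifold₁.boundary_subset hz)
  · intro x
    by_cases hx : (x : X) ∈ range j
    · exact D.manifold₁.exists_chart_push hg hj h₁ hB x hx
    -- Outside the chart the point is off the compact second piece, so it is interior and a chart of
    -- `X` serves.
    · have hO : IsOpen (pushSet g j D.X₂)ᶜ := (hX₂c.image hj.continuous).isClosed.isOpen_compl
      have hxO : (x : X) ∈ (pushSet g j D.X₂)ᶜ := fun h ↦ hx (image_subset_range _ _ h)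
      obtain ⟨φ, h1, h2⟩ := exists_interior_chart hO (compl_subset_compl.2 hcompl) hxO
      refine ⟨φ, h1, fun y hy ↦ iff_of_false (fun h ↦ ?_) (h2 y hy).2.ne'⟩
      rw [hrange] at h
      exact (h2 y hy).1 (image_mono (preimage_mono hE₂) h)
  · exact isCompact_pushSet hg hj hX₂ D.manifold₂.isCompact
  · exact isConnected_pushSet hg hj hX₂ D.manifold₂.isConnected
  · rw [hrange]
    exact image_mono (preimage_mono hE₂)
  · rintro ⟨x, hx⟩
    exact D.manifold₂.exists_chart_push hg hj h₂ hB ⟨x, hx⟩ (image_subset_range _ _ hx)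

end Splitting

/-! ### The inequality -/

theorem mainTheorem11 (K : Knot) (X : Type*) [TopologicalSpace X] [T2Space X] [CompactSpace X]
    [ChartedSpace (EuclideanSpace ℝ (Fin 4)) X] [SimplyConnectedSpace X] :
    doubleSliceGenus X K ≤ doubleSliceGenus (StdSphere 4) K := by
  have : SimplyConnectedSpace (StdSphere 4) := simplyConnectedSpace_stdSphere (by norm_num)
  refine le_iInf fun D ↦ le_iInf fun F₁ ↦ le_iInf fun F₂ ↦ le_iInf fun h₁ ↦ le_iInf fun h₂ ↦
    le_iInf fun hZ ↦ ?_
  -- This is the point at which the connected sum with `X` is formed: interior to the first piece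
  -- and off the surface.
  obtain ⟨p, hp₁, hpS, hpF⟩ := h₁.exists_notMem
  have hp₂ : p ∉ D.X₂ := fun h ↦ hpS (D.inter_eq ▸ ⟨hp₁, h⟩)
  have hg := isOpenEmbedding_inverseStereographic 4 p
  have hgp := range_inverseStereographic 4 p
  obtain ⟨j, hj⟩ := exists_isOpenEmbedding_euclideanSpace (n := 4) X
  obtain ⟨D', hD₁, hD₂, he⟩ := D.exists_push hg hj hgp hp₂
  have hF : F₁ ∪ F₂ ⊆ range (inverseStereographic 4 p) := by
    rw [hgp]
    rintro x (hx | hx) rfl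
    exacts [hpF hx, hp₂ (h₂.subset hx)]
  have hB : j ⁻¹' range D'.e = inverseStereographic 4 p ⁻¹' range D.e := by
    rw [← image_univ, he, preimage_pushSet _ hj.injective, image_univ]
  refine (iInf_le _ D').trans ?_
  refine (iInf₂_le (pushSet (inverseStereographic 4 p) j F₁)
    (pushSet (inverseStereographic 4 p) j F₂)).trans ?_
  have hF₁ := h₁.push hg hj (subset_union_left.trans hF) hD₁ hB
  have hF₂ := h₂.push hg hj (subset_union_right.trans hF) hD₂ hB
  have hZ' := hZ.push hg hj hF
  rw [← he] at hF₁ hF₂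
  rw [pushSet_union] at hZ'
  refine (iInf₂_le hF₁ hF₂).trans ((iInf_le _ hZ').trans (le_of_eq ?_))
  rw [← pushSet_union]
  exact (surfaceGenus_congr (homeomorphPushSet hg hj hF)).symm
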